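/- Let $(\Omega,\mathcal A,\mathbb P)$ be a probability space with a filtration $\mathbb F=(\mathcal F_t)_{t\ge 0}$ satisfying the usual conditions ($\mathbb F$ is right continuous and $\mathcal F_0$ contains all $\mathbb P$-null sets, $\mathcal A$ being $\mathbb P$-complete), let $\tau:\Omega\to[0,+\infty]$ be an $\mathbb F$-stopping time, and let $G$ be a random variable on $(\Omega,\mathcal A)$ with values in a measurable space $(E,\mathcal E)$ and with law $\eta$. Let $\mathbb G=(\mathcal G_t)_{t\ge 0}$ be the punctual enlargement of $\mathbb F$ by $G$ at $\tau$, i.e. the smallest filtration containing $\mathbb F$ such that $A\cap\{\tau\le t\}\in\mathcal G_t$ for all $A\in\sigma(G)$ and $t\ge 0$; explicitly, $$\mathcal G_t=\mathcal F_t\vee\sigma\big(\{A\cap\{\tau\le s\}\mid A\in\sigma(G),\ s\le t\}\big),\qquad t\ge 0.$$ Assume that for every $t\ge 0$ the $\mathcal F_t$-conditional law of $G$ is almost surely equivalent to $\eta$; that is, $G$ has a regular conditional law $\kappa_t(\omega,dx)$ given $\mathcal F_t$ such that, for $\mathbb P$-almost every $\omega$, the measures $\kappa_t(\omega,\cdot)$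 and $\eta$ are mutually absolutely continuous. Then the filtration $\mathbb G$ is right continuous: $\mathcal G_t=\bigcap_{s>t}\mathcal G_s$ for every $t\ge 0$. -/

import Mathlib

open MeasureTheory ProbabilityTheory
open scoped NNReal ENNReal

/-- The usual conditions for a filtration on a probability space `(Ω, 𝒜, P)`: it is right
continuous and its initial σ-algebra contains every `P`-null set. (In Mathlib `P s = 0` means that
`s` is contained in a measurable set of probability zero, so that `𝒜` is `P`-complete too.) -/
structure UsualConditions {Ω : Type*} {mΩ : MeasurableSpace Ω} (P : Measure Ω)
    (F : Filtration ℝ≥0 mΩ) : Prop where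
  rightContinuous : F.IsRightContinuous
  measurableSet_of_null : ∀ s : Set Ω, P s = 0 → MeasurableSet[F 0] s

/-- The punctual enlargement of `F` by `G` at the stopping time `τ`:
`𝒢 t = ℱ t ∨ σ({A ∩ {τ ≤ s} | A ∈ σ(G), s ≤ t})`. -/
def punctualEnlargement {Ω E : Type*} {mΩ : MeasurableSpace Ω} [mE : MeasurableSpace E]
    (F : Filtration ℝ≥0 mΩ) (τ : Ω → WithTop ℝ≥0) (hτ : IsStoppingTime F τ)
    (G : Ω → E) (hG : Measurable G) : Filtration ℝ≥0 mΩ where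
  seq t := F t ⊔ MeasurableSpace.generateFrom
    {B : Set Ω | ∃ A : Set Ω, MeasurableSet[MeasurableSpace.comap G mE] A ∧
      ∃ s : ℝ≥0, s ≤ t ∧ B = A ∩ {ω | τ ω ≤ s}}
  mono' := by
    intro t u htu
    refine sup_le_sup (F.mono htu) (MeasurableSpace.generateFrom_mono ?_)
    rintro B ⟨A, hA, s, hs, rfl⟩
    exact ⟨A, hA, s, hs.trans htu, rfl⟩
  le' := by
    intro t
    refine sup_le (F.le t) (MeasurableSpace.generateFrom_le ?_)
    rintro B ⟨A, hA, s, hs, rfl⟩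
    exact (hG.comap_le A hA).inter (F.le s _ (hτ s))

/-- The punctual enlargement is the smallest filtration `H` that contains `F` and for which `G` is
`H_τ`-measurable, i.e. `A ∩ {τ ≤ t} ∈ H t` for all `A ∈ σ(G)` and all `t`. -/
theorem punctualEnlargement_isLeast {Ω E : Type*} {mΩ : MeasurableSpace Ω}
    [mE : MeasurableSpace E] (F : Filtration ℝ≥0 mΩ) (τ : Ω → WithTop ℝ≥0)
    (hτ : IsStoppingTime F τ) (G : Ω → E) (hG : Measurable G) :
    IsLeast {H : Filtration ℝ≥0 mΩ | F ≤ H ∧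
      ∀ A : Set Ω, MeasurableSet[MeasurableSpace.comap G mE] A →
        ∀ t : ℝ≥0, MeasurableSet[H t] (A ∩ {ω | τ ω ≤ t})}
      (punctualEnlargement F τ hτ G hG) := by
  refine ⟨⟨fun t => le_sup_left, fun A hA t => ?_⟩, ?_⟩
  · exact le_sup_right (a := F t) _
      (MeasurableSpace.measurableSet_generateFrom ⟨A, hA, t, le_rfl, rfl⟩)
  · rintro H ⟨hF, hH⟩ t
    refine sup_le (hF t) (MeasurableSpace.generateFrom_le ?_)
    rintro B ⟨A, hA, s, hs, rfl⟩
    exact H.mono hs _ (hH A hA s)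

/-- `κ` is a (regular) conditional law of `G` given the sub-σ-algebra `m`: an `m`-measurable Markov
kernel with `κ ω B = P(G ∈ B | m)(ω)` for almost every `ω`, for each measurable `B`. -/
def IsCondLaw {Ω E : Type*} {mΩ : MeasurableSpace Ω} [mE : MeasurableSpace E]
    (P : Measure Ω) (m : MeasurableSpace Ω) (G : Ω → E) (κ : @Kernel Ω E m mE) : Prop :=
  IsMarkovKernel κ ∧
    ∀ B : Set E, MeasurableSet B → (fun ω => (κ ω).real B) =ᵐ[P] P⟦G ⁻¹' B | m⟧

/-- Jacod's hypothesis in its equivalence form: for every `t ≥ 0`, the `ℱ t`-conditional law of `G`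
is almost surely equivalent to the law `η = P.map G` of `G`. -/
def JacodEquivalence {Ω E : Type*} {mΩ : MeasurableSpace Ω} [mE : MeasurableSpace E]
    (P : Measure Ω) (F : Filtration ℝ≥0 mΩ) (G : Ω → E) : Prop :=
  ∀ t : ℝ≥0, ∃ κ : @Kernel Ω E (F t) mE, IsCondLaw P (F t) G κ ∧
    ∀ᵐ ω ∂P, κ ω ≪ P.map G ∧ P.map G ≪ κ ω

/-! The traces of `𝒢 t` are those of `F t` on `{t < τ}` and of `F t ⊔ σ(G)` on `{τ ≤ t}`. On the
first event, right continuity comes from `F`. On the second it reduces to the initial enlargement. A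
set in every `F s ⊔ σ(G)`, `s > t`, is a pullback by `(id, G)` of a product set whose sections lie
in `F t`. Such sections do not by themselves give measurability for `F t ⊗ ℰ`, so a jointly
measurable version is built from conditional expectations. It agrees with the original section by
section up to `P`-null sets, and `κ ω ≪ η` carries this over to the random point `G ω`. The null
error lies in `F 0`. -/

open Filter

/-- Monotone class argument from rectangles; no regularity of `Ω` or `E` is needed. -/
theorem exists_measurable_condLExp_section {Ω E : Type*} {m mΩ : MeasurableSpace Ω}
    [mE : MeasurableSpace E] (hm : m ≤ mΩ) (P : Measure[mΩ] Ω) [IsFiniteMeasure P]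
    {Γ : Set (Ω × E)} (hΓ : MeasurableSet[mΩ.prod mE] Γ) :
    ∃ g : Ω × E → ℝ≥0∞, Measurable[m.prod mE] g ∧
      ∀ x, (fun ω => g (ω, x)) =ᵐ[P] condLExp m P (((·, x) ⁻¹' Γ).indicator 1) := by
  have hsec : ∀ {s : Set (Ω × E)} (x : E), MeasurableSet[mΩ.prod mE] s →
      Measurable[mΩ] (((·, x) ⁻¹' s).indicator (1 : Ω → ℝ≥0∞)) := fun x hs =>
    measurable_one.indicator (measurable_prodMk_right hs)
  induction Γ, hΓ using MeasurableSpace.induction_on_inter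
    (h_eq := generateFrom_prod.symm) (h_inter := isPiSystem_prod) with
  | empty => exact ⟨fun _ => 0, @measurable_const _ _ _ (m.prod mE) _, fun x => by
      rw [Set.preimage_empty, Set.indicator_empty']
      exact (condLExp_zero P).symm.eventuallyEq⟩
  | basic s hs =>
    obtain ⟨A, hA, D, hD, rfl⟩ := hs
    refine ⟨fun p => D.indicator 1 p.2 * condLExp m P (A.indicator 1) p.1,
      Measurable.mul ((measurable_one.indicator hD).comp measurable_snd)
        ((measurable_condLExp m P _).comp measurable_fst), fun x => ?_⟩
    by_cases hx : x ∈ D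
    · have : (fun ω => (ω, x)) ⁻¹' (A ×ˢ D) = A := by ext; simp [hx]
      simp only [this, hx, Set.indicator_of_mem, Pi.one_apply, one_mul]
      rfl
    · have : (fun ω => (ω, x)) ⁻¹' (A ×ˢ D) = ∅ := by ext; simp [hx]
      simp only [hx, not_false_eq_true, Set.indicator_of_notMem, zero_mul]
      rw [this, Set.indicator_empty']
      exact (condLExp_zero P).symm.eventuallyEq
  | compl s hs ih =>
    obtain ⟨g, hg, hgx⟩ := ih
    refine ⟨fun p => 1 - g p, measurable_const.sub hg, fun x => ?_⟩
    have hsum : ((·, x) ⁻¹' s).indicator (1 : Ω → ℝ≥0∞) + ((·, x) ⁻¹' sᶜ).indicator 1 = 1 := by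
      rw [Set.preimage_compl, Set.indicator_self_add_compl]
    have hadd := condLExp_add_left (mΩ := m) (((·, x) ⁻¹' sᶜ).indicator (1 : Ω → ℝ≥0∞))
      (hsec x hs).aemeasurable (P := P)
    rw [hsum, condLExp_one hm] at hadd
    filter_upwards [hgx x, hadd] with ω h1 h2
    simp only [Pi.one_apply, Pi.add_apply] at h2
    rw [h1]
    -- Subtraction needs a finite term, which holds because the two conditional expectations sum to
    -- 1.
    refine ENNReal.sub_eq_of_eq_add_rev (fun h => ?_) h2
    simp [h] at h2
  | iUnion f hd hf ih =>
    choose g hg hgx using ih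
    refine ⟨fun p => ∑' i, g i p, (by
      let := m.prod mE
      simp_rw [ENNReal.tsum_eq_iSup_sum]
      exact .iSup fun s => s.measurable_fun_sum fun i _ => hg i), fun x => ?_⟩
    have hsum : ((·, x) ⁻¹' ⋃ i, f i).indicator (1 : Ω → ℝ≥0∞)
        = ∑' i, ((·, x) ⁻¹' f i).indicator 1 := by
      rw [Set.preimage_iUnion, indicator_iUnion_of_pairwise_disjoint _
        fun i j hij => (hd hij).preimage _]
      ext ω
      rw [ENNReal.tsum_apply]
    rw [hsum]
    filter_upwards [ae_all_iff.2 fun i => hgx i x,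
      condLExp_tsum m (P := P) fun i => (hsec x (hf i)).aemeasurable] with ω h1 h2
    rw [h2, ENNReal.tsum_apply]
    exact tsum_congr h1

theorem exists_measurableSet_prod_ae_eq_of_section {Ω E : Type*} {m mΩ : MeasurableSpace Ω}
    [mE : MeasurableSpace E] (hm : m ≤ mΩ) (P : Measure[mΩ] Ω) [IsFiniteMeasure P]
    {Γ : Set (Ω × E)} (hΓ : MeasurableSet[mΩ.prod mE] Γ)
    (hsec : ∀ x, MeasurableSet[m] ((·, x) ⁻¹' Γ)) :
    ∃ Γ' : Set (Ω × E), MeasurableSet[m.prod mE] Γ' ∧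
      ∀ x, ∀ᵐ ω ∂P, (ω, x) ∈ Γ ↔ (ω, x) ∈ Γ' := by
  obtain ⟨g, hg, hgx⟩ := exists_measurable_condLExp_section hm P hΓ
  -- Each section is already `m`-measurable, so `g` is a.s. its indicator.
  refine ⟨g ⁻¹' {1}, hg (measurableSet_singleton 1), fun x => ?_⟩
  have h := hgx x
  rw [condLExp_eq_self hm P (Measurable.indicator (@measurable_one _ _ _ m _) (hsec x))] at h
  filter_upwards [h] with ω hω
  by_cases hmem : (ω, x) ∈ Γ <;> simp [hω, hmem]

/-- The law of `(X, G)` is `P.map X ⊗ₘ κ`, and by Fubini `N` is null for `P.map X` times `η`;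
absolute continuity transfers this to `κ`. -/
theorem measure_prodMk_preimage_eq_zero {Ω S E : Type*} {mΩ : MeasurableSpace Ω}
    [MeasurableSpace S] [MeasurableSpace E] (P : Measure Ω) [IsFiniteMeasure P]
    {X : Ω → S} (hX : Measurable X) {G : Ω → E} (hG : Measurable G)
    (κ : Kernel S E) [IsMarkovKernel κ] (η : Measure E) [SFinite η]
    (hκ : ∀ A, MeasurableSet A → ∀ B, MeasurableSet B →
      ∫⁻ ω in X ⁻¹' A, κ (X ω) B ∂P = P (X ⁻¹' A ∩ G ⁻¹' B))
    (hac : ∀ᵐ ω ∂P, κ (X ω) ≪ η) {N : Set (S × E)} (hN : MeasurableSet N)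
    (hsec : ∀ y, P {ω | (X ω, y) ∈ N} = 0) :
    P {ω | (X ω, G ω) ∈ N} = 0 := by
  have hlaw : P.map (fun ω => (X ω, G ω)) = P.map X ⊗ₘ κ := by
    refine Measure.ext_prod fun {A B} hA hB => ?_
    rw [Measure.map_apply (hX.prodMk hG) (hA.prod hB), Measure.compProd_apply_prod hA hB,
      setLIntegral_map hA (κ.measurable_coe hB) hX, hκ A hA B hB]
    rfl
  have hprod : ((P.map X).prod η) N = 0 := by
    rw [Measure.prod_apply_symm hN]
    simp only [Measure.map_apply hX (measurable_prodMk_right hN)]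
    exact (lintegral_congr fun y => hsec y).trans lintegral_zero
  have hη := ae_of_ae_map hX.aemeasurable
    (Measure.ae_ae_of_ae_prod (measure_eq_zero_iff_ae_notMem.1 hprod))
  have : (P.map X ⊗ₘ κ) N = 0 := by
    rw [Measure.compProd_apply hN,
      lintegral_map (Kernel.measurable_kernel_prodMk_left hN) hX, lintegral_eq_zero_iff
      (f := fun ω => κ (X ω) (Prod.mk (X ω) ⁻¹' N))
      ((Kernel.measurable_kernel_prodMk_left hN).comp hX)]
    filter_upwards [hη, hac] with ω h1 h2
    exact h2 (measure_eq_zero_iff_ae_notMem.2 h1)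
  rwa [← hlaw, Measure.map_apply (hX.prodMk hG) hN] at this

theorem IsCondLaw.setLIntegral_eq {Ω E : Type*} {m mΩ : MeasurableSpace Ω}
    [mE : MeasurableSpace E] {P : Measure[mΩ] Ω} [IsFiniteMeasure P] (hm : m ≤ mΩ) {G : Ω → E}
    (hG : Measurable G) {κ : @Kernel Ω E m mE} (hκ : IsCondLaw P m G κ)
    {A : Set Ω} (hA : MeasurableSet[m] A) {B : Set E} (hB : MeasurableSet B) :
    ∫⁻ ω in A, κ ω B ∂P = P (A ∩ G ⁻¹' B) := by
  have := hκ.1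
  have hint : ∫ ω in A, (κ ω).real B ∂P = P.real (A ∩ G ⁻¹' B) := by
    rw [setIntegral_congr_ae (g := P⟦G ⁻¹' B | m⟧) (hm A hA)
        ((hκ.2 B hB).mono fun ω h _ => h),
      setIntegral_condExp hm ((integrable_const 1).indicator (hG hB)) hA,
      setIntegral_indicator (hG hB)]
    simp
  have hmeas : Measurable[mΩ] fun ω => κ ω B := (Kernel.measurable_coe κ hB).mono hm le_rfl
  have hfin : ∀ ω, κ ω B ≠ ∞ := fun ω => measure_ne_top _ _
  have hbd : ∫⁻ ω in A, κ ω B ∂P ≠ ∞ := by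
    refine ne_top_of_le_ne_top (measure_ne_top P A) ?_
    calc ∫⁻ ω in A, κ ω B ∂P ≤ ∫⁻ _ in A, 1 ∂P := lintegral_mono fun ω => prob_le_one
      _ = P A := by simp
  rw [← ENNReal.toReal_eq_toReal_iff' hbd (measure_ne_top _ _)]
  rw [← integral_toReal hmeas.aemeasurable (ae_of_all _ fun ω => (hfin ω).lt_top)]
  exact hint

/-! ### Initial enlargement by `G`. -/

theorem measurableSet_sup_comap_iff {Ω E : Type*} {m : MeasurableSpace Ω}
    [mE : MeasurableSpace E] (G : Ω → E) (B : Set Ω) :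
    MeasurableSet[m ⊔ mE.comap G] B ↔
      ∃ Γ : Set (Ω × E), MeasurableSet[m.prod mE] Γ ∧ (fun ω => (ω, G ω)) ⁻¹' Γ = B := by
  have h : m ⊔ mE.comap G = (m.prod mE).comap fun ω => (ω, G ω) := by
    rw [MeasurableSpace.prod, MeasurableSpace.comap_sup, MeasurableSpace.comap_comp,
      MeasurableSpace.comap_comp]
    congr 1
    exact MeasurableSpace.comap_id.symm
  rw [h]
  rfl

theorem UsualConditions.measurableSet_of_forall_gt {Ω : Type*} {mΩ : MeasurableSpace Ω}
    {P : Measure Ω} {F : Filtration ℝ≥0 mΩ} (hF : UsualConditions P F) {t : ℝ≥0} {B : Set Ω}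
    (hB : ∀ s > t, MeasurableSet[F s] B) : MeasurableSet[F t] B := by
  have := hF.rightContinuous
  refine Filtration.IsRightContinuous.measurableSet ?_
  rw [Filtration.rightCont_eq]
  simpa [MeasurableSpace.measurableSet_iInf] using hB

/-- Right continuity of the initial enlargement by a variable whose conditional laws are almost
surely absolutely continuous with respect to its law. -/
theorem measurableSet_sup_comap_of_forall_gt {Ω E : Type*} {mΩ : MeasurableSpace Ω}
    [mE : MeasurableSpace E] {P : Measure Ω} [IsProbabilityMeasure P] {F : Filtration ℝ≥0 mΩ}
    (hF : UsualConditions P F) {G : Ω → E} (hG : Measurable G)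
    (hJacod : JacodEquivalence P F G) {t : ℝ≥0} {B : Set Ω}
    (hB : ∀ s > t, MeasurableSet[F s ⊔ mE.comap G] B) :
    MeasurableSet[F t ⊔ mE.comap G] B := by
  obtain ⟨u, hu, hut, hulim⟩ := exists_seq_strictAnti_tendsto t
  have hΓ := fun n => (measurableSet_sup_comap_iff G B).1 (hB (u n) (hut n))
  choose Γ hΓm hΓB using hΓ
  -- The limsup ignores the first `k` sets, so it is measurable at every level `u k` at once.
  have htail : ∀ k, MeasurableSet[(F (u k)).prod mE] (limsup Γ atTop) := by
    intro k
    rw [← limsup_nat_add Γ k]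
    refine @MeasurableSet.measurableSet_limsup _ ((F (u k)).prod mE) _ fun n => ?_
    exact sup_le_sup (MeasurableSpace.comap_mono (F.mono (hu.antitone (Nat.le_add_left k n))))
      le_rfl _ (hΓm (n + k))
  have hlimB : (fun ω => (ω, G ω)) ⁻¹' limsup Γ atTop = B := by
    ext ω
    have : ∀ n, (ω, G ω) ∈ Γ n ↔ ω ∈ B := fun n => by rw [← hΓB n]; rfl
    simp [mem_limsup_iff_frequently_mem, this]
  have hsec : ∀ x, MeasurableSet[F t] ((·, x) ⁻¹' limsup Γ atTop) := by
    refine fun x => hF.measurableSet_of_forall_gt fun s hs => ?_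
    obtain ⟨k, hk⟩ := (hulim.eventually_lt_const hs).exists
    exact F.mono hk.le _ (@measurable_prodMk_right _ _ (F (u k)) mE x _ (htail k))
  obtain ⟨Γ', hΓ', hae⟩ := exists_measurableSet_prod_ae_eq_of_section (F.le t) P
    (sup_le_sup (MeasurableSpace.comap_mono (F.le (u 0))) le_rfl _ (htail 0)) hsec
  obtain ⟨κ, hκ, hac⟩ := hJacod (u 0)
  have hκM := hκ.1
  have hnull : P {ω | (ω, G ω) ∈ symmDiff (limsup Γ atTop) Γ'} = 0 := by
    -- Here `X` is the identity into `Ω` with `F (u 0)`, a level at which both product sets are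
    -- measurable.
    refine @measure_prodMk_preimage_eq_zero Ω Ω E mΩ (F (u 0)) mE P _ id
      (measurable_id'' (F.le (u 0))) G hG κ hκM (P.map G) _
      (fun A hA D hD => hκ.setLIntegral_eq (F.le (u 0)) hG hA hD) (hac.mono fun ω h => h.1) _
      (MeasurableSet.symmDiff (htail 0) (sup_le_sup
        (MeasurableSpace.comap_mono (F.mono (hut 0).le)) le_rfl _ hΓ')) fun x => ?_
    rw [measure_eq_zero_iff_ae_notMem]
    filter_upwards [hae x] with ω hω
    simp [Set.mem_symmDiff, hω]
  have hnullF : ∀ s : Set Ω, P s = 0 → MeasurableSet[F t ⊔ mE.comap G] s := fun s hs =>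
    (F.mono bot_le).trans le_sup_left _ (hF.measurableSet_of_null s hs)
  have hB' : MeasurableSet[F t ⊔ mE.comap G] ((fun ω => (ω, G ω)) ⁻¹' Γ') :=
    (measurableSet_sup_comap_iff G _).2 ⟨Γ', hΓ', rfl⟩
  have hfin := MeasurableSet.symmDiff hB' (hnullF _ hnull)
  convert hfin using 1
  rw [← hlimB]
  ext ω
  simp only [Set.mem_symmDiff, Set.mem_preimage, Set.mem_ofPred_eq]
  tauto

/-! ### Traces on `{t < τ}` and `{τ ≤ t}`. -/

section PunctualEnlargement

variable {Ω E : Type*} {mΩ : MeasurableSpace Ω} [mE : MeasurableSpace E] {F : Filtration ℝ≥0 mΩ}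
  {τ : Ω → WithTop ℝ≥0} (hτ : IsStoppingTime F τ) {G : Ω → E} (hG : Measurable G) {t : ℝ≥0}

theorem punctualEnlargement_le_sup_comap :
    punctualEnlargement F τ hτ G hG t ≤ F t ⊔ mE.comap G := by
  refine sup_le le_sup_left (MeasurableSpace.generateFrom_le ?_)
  rintro B ⟨A, hA, s, hs, rfl⟩
  exact MeasurableSet.inter (le_sup_right (a := F t) _ hA)
    (le_sup_left (a := F t) _ (F.mono hs _ (hτ s)))

theorem measurableSet_inter_lt_of_punctualEnlargement {B : Set Ω}
    (hB : MeasurableSet[punctualEnlargement F τ hτ G hG t] B) :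
    MeasurableSet[F t] (B ∩ {ω | t < τ ω}) := by
  have hlt : MeasurableSet[F t] {ω | t < τ ω} := hτ.measurableSet_gt t
  have hle : (punctualEnlargement F τ hτ G hG t).comap ((↑) : {ω | t < τ ω} → Ω) ≤
      (F t).comap (↑) := by
    change MeasurableSpace.comap _ (F t ⊔ MeasurableSpace.generateFrom _) ≤ _
    rw [MeasurableSpace.comap_sup, MeasurableSpace.comap_generateFrom]
    refine sup_le le_rfl (MeasurableSpace.generateFrom_le ?_)
    rintro _ ⟨_, ⟨A, hA, s, hs, rfl⟩, rfl⟩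
    -- Generators `A ∩ {τ ≤ s}` with `s ≤ t` do not meet `{t < τ}`.
    convert @MeasurableSet.empty _ ((F t).comap _)
    ext ω
    have hst : (s : WithTop ℝ≥0) < τ ω := lt_of_le_of_lt (WithTop.coe_le_coe.2 hs) ω.2
    exact iff_of_false (fun h => hst.not_ge h.2) id
  obtain ⟨C, hC, hCB⟩ := hle _ ⟨B, hB, rfl⟩
  rw [Subtype.preimage_coe_eq_preimage_coe_iff, Set.inter_comm, Set.inter_comm _ B] at hCB
  rw [← hCB]
  exact hC.inter hlt

theorem measurableSet_punctualEnlargement_inter_le {C : Set Ω}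
    (hC : MeasurableSet[F t ⊔ mE.comap G] C) :
    MeasurableSet[punctualEnlargement F τ hτ G hG t] (C ∩ {ω | τ ω ≤ t}) := by
  have hmem := (punctualEnlargement_isLeast F τ hτ G hG).1
  have hτt : MeasurableSet[punctualEnlargement F τ hτ G hG t] {ω | τ ω ≤ t} :=
    hmem.1 t _ (hτ t)
  have hle : (F t ⊔ mE.comap G).comap ((↑) : {ω | τ ω ≤ t} → Ω) ≤
      (punctualEnlargement F τ hτ G hG t).comap (↑) := by
    rw [MeasurableSpace.comap_sup]
    refine sup_le (MeasurableSpace.comap_mono (hmem.1 t)) ?_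
    rintro _ ⟨A, hA, rfl⟩
    exact ⟨_, hmem.2 A hA t, by
      ext ω
      exact ⟨fun h => h.1, fun h => ⟨h, ω.2⟩⟩⟩
  obtain ⟨D, hD, hDC⟩ := hle _ ⟨C, hC, rfl⟩
  rw [Subtype.preimage_coe_eq_preimage_coe_iff, Set.inter_comm, Set.inter_comm _ C] at hDC
  rw [← hDC]
  exact hD.inter hτt

end PunctualEnlargement

theorem mainTheorem5 {Ω E : Type*} {mΩ : MeasurableSpace Ω} [mE : MeasurableSpace E]
    (P : Measure Ω) [IsProbabilityMeasure P]
    (F : Filtration ℝ≥0 mΩ) (hF : UsualConditions P F)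
    (τ : Ω → WithTop ℝ≥0) (hτ : IsStoppingTime F τ)
    (G : Ω → E) (hG : Measurable G)
    (hJacod : JacodEquivalence P F G) :
    (punctualEnlargement F τ hτ G hG).IsRightContinuous := by
  refine ⟨fun t B hB => ?_⟩
  rw [Filtration.rightCont_eq] at hB
  simp only [MeasurableSpace.measurableSet_iInf] at hB
  have hle := measurableSet_punctualEnlargement_inter_le hτ hG
    (measurableSet_sup_comap_of_forall_gt hF hG hJacod fun s hs =>
      punctualEnlargement_le_sup_comap hτ hG _ (hB s hs))
  have hgt : MeasurableSet[F t] (B ∩ {ω | t < τ ω}) := by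
    obtain ⟨u, hu, hut, hulim⟩ := exists_seq_strictAnti_tendsto t
    refine hF.measurableSet_of_forall_gt fun s hs => ?_
    obtain ⟨k, hk⟩ := (hulim.eventually_lt_const hs).exists
    -- The shift by `k` keeps every level below `s`, so each piece lies in `F s`.
    have hUnion : B ∩ {ω | t < τ ω} = ⋃ n, B ∩ {ω | (u (n + k) : WithTop ℝ≥0) < τ ω} := by
      rw [← Set.inter_iUnion]
      congr 1
      ext ω
      simp only [Set.mem_ofPred_eq, Set.mem_iUnion]
      refine ⟨fun h => ?_, fun ⟨n, hn⟩ => (WithTop.coe_lt_coe.2 (hut _)).trans hn⟩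
      have hlim := (tendsto_add_atTop_iff_nat k).2 hulim
      cases hτω : τ ω with
      | top => exact ⟨0, WithTop.coe_lt_top _⟩
      | coe r =>
        rw [hτω, WithTop.coe_lt_coe] at h
        obtain ⟨n, hn⟩ := (hlim.eventually_lt_const h).exists
        exact ⟨n, WithTop.coe_lt_coe.2 hn⟩
    rw [hUnion]
    refine MeasurableSet.iUnion fun n => ?_
    exact F.mono ((hu.antitone (Nat.le_add_left k n)).trans hk.le) _
      (measurableSet_inter_lt_of_punctualEnlargement hτ hG (hB _ (hut _)))
  have hsplit : B = B ∩ {ω | τ ω ≤ t} ∪ B ∩ {ω | t < τ ω} := by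
    ext ω
    exact ⟨fun h => (le_or_gt (τ ω) t).imp (⟨h, ·⟩) (⟨h, ·⟩), fun h => h.elim And.left And.left⟩
  rw [hsplit]
  exact hle.union ((punctualEnlargement_isLeast F τ hτ G hG).1.1 t _ hgt)
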